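/- Let $R$ be a commutative Noetherian ring with identity, let $n \ge 4$ be an integer, let $I \subseteq R$ be an ideal that can be generated by $n$ elements (not necessarily minimally), and let $M$ be an arbitrary $R$-module. For an ideal $\mathfrak a$ of $R$ and $i \ge 0$ write $H^i_{\mathfrak a}(M) := \varinjlim_t \operatorname{Ext}^i_R(R/\mathfrak a^t, M)$ for the $i$-th local cohomology module of $M$ with support in $\mathfrak a$. Then there exists an ideal $J \subseteq R$ that can be generated by at most three elements such that $H^n_I(M) \cong H^3_J(M)$ as $R$-modules. -/

import Mathlib

universe u

open CategoryTheory

/-! It suffices to pass from `n + 1` generators in degree `n + 1` to `n` generators in degree `n`,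
for `n ≥ 3`. Split the generators into two of them and the remaining `n - 1`, generating `A` and
`B`. Both ideals have fewer than `n` generators, so their local cohomology vanishes in degrees `n`
and `n + 1`, and Mayer-Vietoris gives `H^{n+1}_{A+B} ≅ H^n_{AB}`. Up to radical `AB` needs only `2 +
(n - 1) - 1 = n` generators: the coefficients of a product of two polynomials whose coefficients
generate `A` and `B` (`Ideal.exists_span_radical_eq_mul`).

Vanishing (`supportedExactAt_span`) and Mayer-Vietoris (`nonempty_supportedCohomology_equiv`) are
proved by elements on the subcomplexes of supported elements in an injective resolution. Dimension
shifting along cosyzygies identifies the colimit of `Ext` modules with the cohomology of such a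
subcomplex (`localCohomology.nonempty_iso_supportedCohomology`). -/

/-! ### Extension properties of injective modules, and Artin-Rees. -/

section InjectiveModules

variable {R : Type u} [CommRing R] {E : Type u} [AddCommGroup E] [Module R E]

theorem Module.Injective.exists_smul_eq [Module.Injective R E] (a : R) (e : E)
    (h : ∀ r : R, r * a = 0 → r • e = 0) : ∃ w : E, a • w = e := by
  let f : R →ₗ[R] R := LinearMap.toSpanSingleton R R a
  have hle : LinearMap.ker f ≤ LinearMap.ker (LinearMap.toSpanSingleton R E e) := by
    intro r hr
    simpa using h r (by simpa [f] using hr)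
  obtain ⟨g, hg⟩ := Module.Injective.out (Q := E) ((LinearMap.ker f).liftQ f le_rfl)
    (LinearMap.ker_eq_bot.mp (Submodule.ker_liftQ_eq_bot _ _ _ le_rfl))
    ((LinearMap.ker f).liftQ _ hle)
  refine ⟨g 1, ?_⟩
  have h1 := hg (Submodule.Quotient.mk 1)
  simp only [Submodule.liftQ_apply, f, LinearMap.toSpanSingleton_apply, one_smul] at h1
  rw [← h1, ← map_smul, smul_eq_mul, mul_one]

/-- `R/(A ∩ B)` embeds in `R/A × R/B`, so the map `1 ↦ e` extends to the product; the two factors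
give `u` and `v`. -/
theorem Module.Injective.exists_add_eq [Module.Injective R E] (A B : Ideal R) (e : E)
    (h : A ⊓ B ≤ Ideal.torsionOf R E e) :
    ∃ u v : E, u + v = e ∧ A ≤ Ideal.torsionOf R E u ∧ B ≤ Ideal.torsionOf R E v := by
  let f : R →ₗ[R] (R ⧸ A) × (R ⧸ B) := (Submodule.mkQ A).prod (Submodule.mkQ B)
  have hf : LinearMap.ker f = A ⊓ B := by
    simp [f, LinearMap.ker_prod]
  have hle : LinearMap.ker f ≤ LinearMap.ker (LinearMap.toSpanSingleton R E e) := hf ▸ h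
  obtain ⟨g, hg⟩ := Module.Injective.out (Q := E) ((LinearMap.ker f).liftQ f le_rfl)
    (LinearMap.ker_eq_bot.mp (Submodule.ker_liftQ_eq_bot _ _ _ le_rfl))
    ((LinearMap.ker f).liftQ _ hle)
  refine ⟨g (Submodule.Quotient.mk 1, 0), g (0, Submodule.Quotient.mk 1), ?_, ?_, ?_⟩
  · have h1 := hg (Submodule.Quotient.mk 1)
    simp only [Submodule.liftQ_apply, LinearMap.toSpanSingleton_apply, one_smul] at h1
    rw [← h1, ← map_add]
    simp [f]
  · intro r hr
    rw [Ideal.mem_torsionOf_iff, ← map_smul, Prod.smul_mk, ← Submodule.Quotient.mk_smul,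
      (Submodule.Quotient.mk_eq_zero A).mpr (by simpa using hr)]
    rw [smul_zero]
    exact map_zero g
  · intro r hr
    rw [Ideal.mem_torsionOf_iff, ← map_smul, Prod.smul_mk, ← Submodule.Quotient.mk_smul,
      (Submodule.Quotient.mk_eq_zero B).mpr (by simpa using hr)]
    rw [smul_zero]
    exact map_zero g

theorem Ideal.exists_pow_inf_le_pow_mul [IsNoetherianRing R] (I N : Ideal R) (k : ℕ) :
    ∃ m : ℕ, I ^ m ⊓ N ≤ I ^ k * N := by
  obtain ⟨c, hc⟩ := Ideal.exists_pow_inf_eq_pow_smul I N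
  refine ⟨c + k, ?_⟩
  have h := hc (c + k) (Nat.le_add_right _ _)
  simp only [smul_eq_mul, Ideal.mul_top, Nat.add_sub_cancel_left] at h
  exact h.le.trans (Ideal.mul_mono_right inf_le_right)

end InjectiveModules

/-! ### Torsion functors on injective modules over a Noetherian ring. -/

section RadicalTorsion

variable {R : Type u} [CommRing R]

/-- The submodule of elements supported in `V(I)`. Over a Noetherian ring these are the elements
killed by some power of `I`. -/
def Ideal.supportedSubmodule (I : Ideal R) (E : Type u) [AddCommGroup E] [Module R E] :
    Submodule R E where
  carrier := {z | I ≤ (Ideal.torsionOf R E z).radical}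
  zero_mem' := by simp [Ideal.radical_top]
  add_mem' {z w} hz hw := by
    refine (le_inf (α := Ideal R) hz hw).trans ?_
    rw [← Ideal.radical_inf]
    refine Ideal.radical_mono fun r hr => ?_
    have h1 : r • z = 0 := hr.1
    have h2 : r • w = 0 := hr.2
    rw [Ideal.mem_torsionOf_iff, smul_add, h1, h2, add_zero]
  smul_mem' c z hz := by
    refine le_trans hz (Ideal.radical_mono fun r hr => ?_)
    have h1 : r • z = 0 := hr
    rw [Ideal.mem_torsionOf_iff, smul_comm, h1, smul_zero]

variable {E F : Type u} [AddCommGroup E] [Module R E] [AddCommGroup F] [Module R F]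

namespace Ideal

theorem mem_supportedSubmodule {I : Ideal R} {z : E} :
    z ∈ I.supportedSubmodule E ↔ I ≤ (Ideal.torsionOf R E z).radical := Iff.rfl

theorem supportedSubmodule_anti {I J : Ideal R} (h : I ≤ J.radical) :
    J.supportedSubmodule E ≤ I.supportedSubmodule E := fun _ hz =>
  h.trans (Ideal.radical_le_radical_iff.mpr hz)

theorem supportedSubmodule_sup (I J : Ideal R) :
    (I ⊔ J).supportedSubmodule E = I.supportedSubmodule E ⊓ J.supportedSubmodule E := by
  ext z
  simp [mem_supportedSubmodule]

theorem supportedSubmodule_bot : (⊥ : Ideal R).supportedSubmodule E = ⊤ := by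
  ext z
  simp [mem_supportedSubmodule]

theorem map_mem_supportedSubmodule {I : Ideal R} (f : E →ₗ[R] F) {z : E}
    (hz : z ∈ I.supportedSubmodule E) : f z ∈ I.supportedSubmodule F := by
  refine le_trans hz (Ideal.radical_mono fun r hr => ?_)
  have h1 : r • z = 0 := hr
  rw [Ideal.mem_torsionOf_iff, ← map_smul, h1, map_zero]

theorem mem_supportedSubmodule_of_map {I : Ideal R} (f : E →ₗ[R] F) (hf : Function.Injective f)
    {z : E} (hz : f z ∈ I.supportedSubmodule F) : z ∈ I.supportedSubmodule E := by
  refine le_trans hz (Ideal.radical_mono fun r hr => ?_)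
  have h1 : r • f z = 0 := hr
  rw [Ideal.mem_torsionOf_iff]
  exact hf (by rw [map_smul, h1, map_zero])

theorem mem_supportedSubmodule_span_singleton {x : R} {z : E} :
    z ∈ (Ideal.span {x}).supportedSubmodule E ↔ ∃ k : ℕ, x ^ k • z = 0 := by
  rw [mem_supportedSubmodule, Ideal.span_singleton_le_iff_mem]
  exact Iff.rfl

theorem mem_supportedSubmodule_of_pow_le {I : Ideal R} {z : E} {k : ℕ}
    (h : I ^ k ≤ Ideal.torsionOf R E z) : z ∈ I.supportedSubmodule E :=
  fun _ ha => ⟨k, h (Ideal.pow_mem_pow ha k)⟩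

variable [IsNoetherianRing R]

theorem mem_supportedSubmodule_iff_exists_pow {I : Ideal R} {z : E} :
    z ∈ I.supportedSubmodule E ↔ ∃ k : ℕ, I ^ k ≤ Ideal.torsionOf R E z :=
  ⟨fun h => Ideal.exists_pow_le_of_le_radical_of_fg h (IsNoetherian.noetherian I),
    fun ⟨_, h⟩ => mem_supportedSubmodule_of_pow_le h⟩

/-- Some `(IJ)^k` kills `z`, and by Artin-Rees `I^m ∩ J^k ≤ I^k J^k`; now split `z` along `I^m` and
`J^k`. This is the surjectivity needed for Mayer-Vietoris. -/
theorem exists_add_eq_of_mem_supportedSubmodule [Module.Injective R E] {I J K : Ideal R}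
    (h : I * J ≤ K.radical) {z : E} (hz : z ∈ K.supportedSubmodule E) :
    ∃ u ∈ I.supportedSubmodule E, ∃ v ∈ J.supportedSubmodule E, u + v = z := by
  obtain ⟨k, hk⟩ := mem_supportedSubmodule_iff_exists_pow.mp (supportedSubmodule_anti h hz)
  obtain ⟨m, hm⟩ := Ideal.exists_pow_inf_le_pow_mul I (J ^ k) k
  obtain ⟨u, v, huv, hu, hv⟩ := Module.Injective.exists_add_eq (I ^ m) (J ^ k) z
    (hm.trans (by rwa [← mul_pow]))
  exact ⟨u, mem_supportedSubmodule_of_pow_le hu, v, mem_supportedSubmodule_of_pow_le hv, huv⟩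

theorem exists_pow_smul_eq_zero (I : Ideal R) (N : Submodule R E) (hN : N.FG)
    (hNI : N ≤ I.supportedSubmodule E) : ∃ k : ℕ, ∀ a ∈ I ^ k, ∀ z ∈ N, a • z = 0 := by
  induction N, hN using Submodule.fg_induction with
  | singleton z =>
    obtain ⟨k, hk⟩ := mem_supportedSubmodule_iff_exists_pow.mp
      (hNI (Submodule.mem_span_singleton_self z))
    refine ⟨k, fun a ha y hy => ?_⟩
    obtain ⟨r, rfl⟩ := Submodule.mem_span_singleton.mp hy
    have h1 : a • z = 0 := hk ha
    rw [smul_comm, h1, smul_zero]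
  | sup N₁ N₂ _ _ h₁ h₂ =>
    obtain ⟨k₁, hk₁⟩ := h₁ (le_sup_left.trans hNI)
    obtain ⟨k₂, hk₂⟩ := h₂ (le_sup_right.trans hNI)
    refine ⟨k₁ + k₂, fun a ha y hy => ?_⟩
    obtain ⟨y₁, hy₁, y₂, hy₂, rfl⟩ := Submodule.mem_sup.mp hy
    rw [smul_add, hk₁ a (Ideal.pow_le_pow_right (Nat.le_add_right _ _) ha) _ hy₁,
      hk₂ a (Ideal.pow_le_pow_right (Nat.le_add_left _ _) ha) _ hy₂, add_zero]

/-- Baer's criterion: extend to `E`, then correct the value at `1` by an element killed by `C` so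
that it becomes `I`-torsion. -/
instance injective_supportedSubmodule [Module.Injective R E] (I : Ideal R) :
    Module.Injective R (I.supportedSubmodule E) := by
  refine Module.Baer.injective fun C g => ?_
  obtain ⟨e, he⟩ : ∃ e : E, ∀ x (hx : x ∈ C), x • e = g ⟨x, hx⟩ := by
    obtain ⟨g', hg'⟩ := (Module.Baer.of_injective (R := R) (Q := E) inferInstance) C
      ((I.supportedSubmodule E).subtype ∘ₗ g)
    refine ⟨g' 1, fun x hx => ?_⟩
    rw [← map_smul, smul_eq_mul, mul_one, hg' x hx]
    rfl
  have hfg : (LinearMap.range ((I.supportedSubmodule E).subtype ∘ₗ g)).FG := by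
    rw [LinearMap.range_eq_map]
    exact (IsNoetherian.noetherian (⊤ : Submodule R C)).map _
  obtain ⟨k, hk⟩ := exists_pow_smul_eq_zero I _ hfg (by
    rintro _ ⟨x, rfl⟩
    exact (g x).2)
  obtain ⟨m, hm⟩ := Ideal.exists_pow_inf_le_pow_mul I C k
  -- `I^m ∩ C ≤ I^k C` kills `e`, since `I^k` kills the finitely generated image of `C`.
  obtain ⟨u, v, huv, hu, hv⟩ := Module.Injective.exists_add_eq (I ^ m) C e (by
    refine hm.trans (Ideal.mul_le.mpr fun a ha x hx => ?_)
    rw [Ideal.mem_torsionOf_iff, mul_smul, he x hx]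
    exact hk a ha _ ⟨⟨x, hx⟩, rfl⟩)
  refine ⟨LinearMap.toSpanSingleton R _ ⟨u, mem_supportedSubmodule_of_pow_le hu⟩,
    fun x hx => Subtype.ext ?_⟩
  have hv0 : x • v = 0 := hv hx
  rw [← he x hx, ← huv, smul_add, hv0, add_zero]
  rfl

/-- Modulo `x`-power torsion an injective module is `x`-divisible. Once the annihilators of the
`x^m` stabilize, nothing obstructs dividing `x^m • w` by `x^(m+k)`. -/
theorem exists_pow_smul_sub_eq_zero [Module.Injective R E] (x : R) (k : ℕ) (w : E) :
    ∃ (w' : E) (m : ℕ), x ^ m • (w - x ^ k • w') = 0 := by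
  let f : ℕ →o Ideal R :=
    { toFun m := Ideal.torsionOf R R (x ^ m)
      monotone' a b hab r hr := by
        obtain ⟨c, rfl⟩ := Nat.exists_eq_add_of_le hab
        have h1 : r * x ^ a = 0 := hr
        change r * x ^ (a + c) = 0
        rw [pow_add, ← mul_assoc, h1, zero_mul] }
  obtain ⟨m, hm⟩ := monotone_stabilizes_iff_noetherian.mpr
    (inferInstance : IsNoetherian R R) f
  obtain ⟨w', hw'⟩ := Module.Injective.exists_smul_eq (x ^ (m + k)) (x ^ m • w) (by
    intro r hr
    have h1 : r ∈ f m := by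
      rw [hm (m + k) (Nat.le_add_right _ _)]
      exact hr
    have h2 : r * x ^ m = 0 := h1
    rw [smul_smul, h2, zero_smul])
  refine ⟨w', m, ?_⟩
  rw [smul_sub, smul_smul, ← pow_add, hw', sub_self]

end Ideal

end RadicalTorsion

/-! ### Generating a product of ideals up to radical. -/

section ContentIdeal

open Polynomial

variable {R : Type u} [CommRing R]

theorem Polynomial.contentIdeal_C_add_X_mul (a : R) (p : R[X]) :
    (C a + X * p).contentIdeal = Ideal.span {a} ⊔ p.contentIdeal := by
  apply le_antisymm
  · rw [contentIdeal_def, Ideal.span_le]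
    intro c hc
    obtain ⟨k, -, rfl⟩ := Polynomial.mem_coeffs_iff.mp hc
    rcases k with _ | k
    · simpa using Ideal.mem_sup_left (Ideal.mem_span_singleton_self a)
    · simpa [coeff_C] using Ideal.mem_sup_right (p.coeff_mem_contentIdeal k)
  · refine sup_le ?_ ?_
    · rw [Ideal.span_singleton_le_iff_mem]
      have h := (C a + X * p).coeff_mem_contentIdeal 0
      simpa only [coeff_add, coeff_C_zero, coeff_X_mul_zero, add_zero] using h
    · rw [contentIdeal_def, Ideal.span_le]
      intro c hc
      obtain ⟨k, -, rfl⟩ := Polynomial.mem_coeffs_iff.mp hc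
      have h := (C a + X * p).coeff_mem_contentIdeal (k + 1)
      simpa only [SetLike.mem_coe, coeff_add, coeff_C_succ, coeff_X_mul, zero_add] using h

theorem Polynomial.exists_contentIdeal_eq_span (s : Finset R) :
    ∃ p : R[X], p.contentIdeal = Ideal.span (s : Set R) ∧ p.natDegree ≤ s.card - 1 := by
  classical
  suffices ∃ p : R[X], p.contentIdeal = Ideal.span (s : Set R) ∧ p.degree < s.card by
    obtain ⟨p, hp, hd⟩ := this
    refine ⟨p, hp, ?_⟩
    rcases eq_or_ne p 0 with rfl | h0
    · simp
    · have := (natDegree_lt_iff_degree_lt h0).mpr hd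
      omega
  induction s using Finset.induction_on with
  | empty => exact ⟨0, by simp, by simp⟩
  | insert a s ha ih =>
    obtain ⟨p, hp, hd⟩ := ih
    refine ⟨C a + X * p, ?_, ?_⟩
    · rw [contentIdeal_C_add_X_mul, hp, Finset.coe_insert, Ideal.span_insert]
    · rw [Finset.card_insert_of_notMem ha, degree_lt_iff_coeff_zero]
      intro m hm
      obtain ⟨k, rfl⟩ : ∃ k, m = k + 1 := ⟨m - 1, by omega⟩
      have : p.coeff k = 0 := (degree_lt_iff_coeff_zero _ _).mp hd k (by omega)
      simp [this]

/-- `c(pq)` and `c(p)c(q)` have the same radical, and a polynomial has at most one more coefficient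
than its degree. Degrees add, which saves one generator over `|s| + |t|`. -/
theorem Ideal.exists_span_radical_eq_mul (s t : Finset R) :
    ∃ w : Finset R, w.card ≤ (s.card - 1) + (t.card - 1) + 1 ∧
      Ideal.span (w : Set R) ≤ Ideal.span (s : Set R) * Ideal.span (t : Set R) ∧
      Ideal.span (s : Set R) * Ideal.span (t : Set R) ≤ (Ideal.span (w : Set R)).radical := by
  classical
  obtain ⟨p, hp, hpd⟩ := exists_contentIdeal_eq_span s
  obtain ⟨q, hq, hqd⟩ := exists_contentIdeal_eq_span t
  refine ⟨(p * q).coeffs, ?_, ?_, ?_⟩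
  · refine Finset.card_image_le.trans ((card_supp_le_succ_natDegree _).trans ?_)
    have := natDegree_mul_le (p := p) (q := q)
    omega
  · rw [← hp, ← hq]
    exact contentIdeal_mul_le_mul_contentIdeal p q
  · rw [← hp, ← hq]
    exact mul_contentIdeal_le_radical_contentIdeal_mul

end ContentIdeal

/-! ### Vanishing and Mayer-Vietoris for supported elements of an injective complex. -/

section SupportedCohomology

variable {R : Type u} [CommRing R] {E : ℕ → Type u} [∀ k, AddCommGroup (E k)]
  [∀ k, Module R (E k)] (d : ∀ k, E k →ₗ[R] E (k + 1))

/-- The cocycles in degree `n + 1` supported in `V(I)`. -/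
def supportedCocycles (I : Ideal R) (n : ℕ) : Submodule R (E (n + 1)) :=
  I.supportedSubmodule (E (n + 1)) ⊓ LinearMap.ker (d (n + 1))

/-- The coboundaries in degree `n + 1` of elements supported in `V(I)`. -/
def supportedCoboundaries (I : Ideal R) (n : ℕ) : Submodule R (supportedCocycles d I n) :=
  ((I.supportedSubmodule (E n)).map (d n)).submoduleOf (supportedCocycles d I n)

/-- The cohomology in degree `n + 1` of the elements supported in `V(I)`. -/
abbrev SupportedCohomology (I : Ideal R) (n : ℕ) : Type u :=
  supportedCocycles d I n ⧸ supportedCoboundaries d I n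

/-- Every cocycle in degree `n + 1` supported in `V(I)` is the coboundary of an element supported
in `V(I)`. -/
def SupportedExactAt (I : Ideal R) (n : ℕ) : Prop :=
  ∀ z ∈ I.supportedSubmodule (E (n + 1)), d (n + 1) z = 0 →
    ∃ y ∈ I.supportedSubmodule (E n), d n y = z

/-- Cohomology vanishes above the number of generators. Adjoining `x`, a primitive `y` supported on
`s` is corrected by a coboundary so as to become `x`-torsion too. -/
theorem supportedExactAt_span [IsNoetherianRing R] [∀ k, Module.Injective R (E k)]
    (hd : ∀ k, Function.Exact (d k) (d (k + 1))) (s : Finset R) (n : ℕ) (hn : s.card ≤ n) :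
    SupportedExactAt d (Ideal.span (s : Set R)) n := by
  classical
  induction s using Finset.induction_on generalizing n with
  | empty =>
    intro z _ hz
    obtain ⟨y, hy⟩ := (hd n z).mp hz
    exact ⟨y, by simp [Ideal.supportedSubmodule_bot], hy⟩
  | insert x s hx ih =>
    rw [Finset.card_insert_of_notMem hx] at hn
    obtain ⟨n, rfl⟩ : ∃ m, n = m + 1 := ⟨n - 1, by omega⟩
    rw [Finset.coe_insert, Ideal.span_insert]
    intro z hz hdz
    rw [Ideal.supportedSubmodule_sup] at hz ⊢
    obtain ⟨y, hy, rfl⟩ := ih (n + 1) (by omega) z hz.2 hdz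
    obtain ⟨k, hk⟩ := Ideal.mem_supportedSubmodule_span_singleton.mp hz.1
    obtain ⟨w, hw, hdw⟩ := ih n (by omega) (x ^ k • y) (Submodule.smul_mem _ _ hy)
      (by rw [map_smul, hk])
    -- Dividing inside the torsion submodule, itself injective, keeps `w'` supported on `s`. Then
    -- `x^k (y - d w') = d (w - x^k w')` is `x`-torsion.
    obtain ⟨w', m, hw'⟩ := Ideal.exists_pow_smul_sub_eq_zero x k
      (⟨w, hw⟩ : (Ideal.span (s : Set R)).supportedSubmodule (E n))
    refine ⟨y - d n w', ⟨?_, ?_⟩, ?_⟩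
    · refine Ideal.mem_supportedSubmodule_span_singleton.mpr ⟨m + k, ?_⟩
      have h1 : x ^ m • (w - x ^ k • (w' : E n)) = 0 := congrArg Subtype.val hw'
      have h2 : x ^ k • (y - d n w') = d n (w - x ^ k • (w' : E n)) := by
        rw [map_sub, map_smul, hdw, smul_sub]
      rw [pow_add, mul_smul, h2, ← map_smul, h1, map_zero]
    · exact Submodule.sub_mem _ hy (Ideal.map_mem_supportedSubmodule _ w'.2)
    · rw [map_sub, (hd n).apply_apply_eq_zero, sub_zero]

/-- The degree shift in the Mayer-Vietoris sequence of `I` and `J`, when the cohomology of the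
elements supported in `V(I)` and in `V(J)` vanishes in the relevant degrees. -/
theorem nonempty_supportedCohomology_equiv [IsNoetherianRing R] [∀ k, Module.Injective R (E k)]
    (hd : ∀ k, Function.Exact (d k) (d (k + 1))) {I J K : Ideal R} {n : ℕ}
    (hKI : K ≤ I * J) (hIK : I * J ≤ K.radical)
    (hI : SupportedExactAt d I n) (hJ : SupportedExactAt d J n)
    (hI' : SupportedExactAt d I (n + 1)) (hJ' : SupportedExactAt d J (n + 1)) :
    Nonempty (SupportedCohomology d (I ⊔ J) (n + 1) ≃ₗ[R] SupportedCohomology d K n) := by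
  have hdd : ∀ k z, d (k + 1) (d k z) = 0 := fun k z => (hd k).apply_apply_eq_zero z
  have hIle : ∀ k, I.supportedSubmodule (E k) ≤ K.supportedSubmodule (E k) := fun k =>
    Ideal.supportedSubmodule_anti ((hKI.trans Ideal.mul_le_left).trans Ideal.le_radical)
  have hJle : ∀ k, J.supportedSubmodule (E k) ≤ K.supportedSubmodule (E k) := fun k =>
    Ideal.supportedSubmodule_anti ((hKI.trans Ideal.mul_le_right).trans Ideal.le_radical)
  let D : E (n + 1) × E (n + 1) →ₗ[R] E (n + 2) := (d (n + 1)).coprod (d (n + 1))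
  -- The connecting map as a correspondence: a pair `(u, v)` with `du + dv = 0` gives the cocycle `u
  -- + v` for `K` and `du` for `I ⊔ J`. Both maps are onto and pull coboundaries back to the same
  -- submodule.
  let W : Submodule R (E (n + 1) × E (n + 1)) :=
    ((I.supportedSubmodule (E (n + 1))).prod (J.supportedSubmodule (E (n + 1)))) ⊓
      LinearMap.ker D
  have hW : ∀ w : W, (w : E (n + 1) × E (n + 1)).1 ∈ I.supportedSubmodule (E (n + 1)) ∧
      (w : E (n + 1) × E (n + 1)).2 ∈ J.supportedSubmodule (E (n + 1)) ∧
      d (n + 1) (w : E (n + 1) × E (n + 1)).1 + d (n + 1) (w : E (n + 1) × E (n + 1)).2 = 0 :=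
    fun w => ⟨w.2.1.1, w.2.1.2, w.2.2⟩
  let f : W →ₗ[R] supportedCocycles d K n :=
    ((LinearMap.fst R _ _ + LinearMap.snd R _ _) ∘ₗ W.subtype).codRestrict _ (by
      intro w
      obtain ⟨h1, h2, h3⟩ := hW w
      refine ⟨Submodule.add_mem _ (hIle _ h1) (hJle _ h2), ?_⟩
      simpa using h3)
  let g : W →ₗ[R] supportedCocycles d (I ⊔ J) (n + 1) :=
    (d (n + 1) ∘ₗ LinearMap.fst R _ _ ∘ₗ W.subtype).codRestrict _ (by
      intro w
      obtain ⟨h1, h2, h3⟩ := hW w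
      refine ⟨?_, hdd _ _⟩
      rw [Ideal.supportedSubmodule_sup]
      refine ⟨Ideal.map_mem_supportedSubmodule (d (n + 1)) h1, ?_⟩
      have h4 := Ideal.map_mem_supportedSubmodule (d (n + 1)) (Submodule.neg_mem _ h2)
      rwa [map_neg, ← eq_neg_of_add_eq_zero_left h3] at h4)
  have hf : Function.Surjective f := by
    rintro ⟨z, hz, hdz⟩
    obtain ⟨u, hu, v, hv, rfl⟩ := Ideal.exists_add_eq_of_mem_supportedSubmodule hIK hz
    exact ⟨⟨(u, v), ⟨hu, hv⟩, by simpa [D] using hdz⟩, Subtype.ext rfl⟩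
  have hg : Function.Surjective g := by
    rintro ⟨z, hz, hdz⟩
    rw [Ideal.supportedSubmodule_sup] at hz
    obtain ⟨u, hu, hdu⟩ := hI' z hz.1 hdz
    obtain ⟨v, hv, hdv⟩ := hJ' z hz.2 hdz
    exact ⟨⟨(u, -v), ⟨hu, Submodule.neg_mem _ hv⟩, by simp [D, hdu, hdv]⟩, Subtype.ext hdu⟩
  have hker : (supportedCoboundaries d (I ⊔ J) (n + 1)).comap g =
      (supportedCoboundaries d K n).comap f := by
    ext w
    obtain ⟨h1, h2, h3⟩ := hW w
    obtain ⟨⟨u, v⟩, hw⟩ := w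
    change (∃ y ∈ (I ⊔ J).supportedSubmodule (E (n + 1)), d (n + 1) y = d (n + 1) u) ↔
      ∃ y ∈ K.supportedSubmodule (E n), d n y = u + v
    change u ∈ I.supportedSubmodule (E (n + 1)) at h1
    change v ∈ J.supportedSubmodule (E (n + 1)) at h2
    change d (n + 1) u + d (n + 1) v = 0 at h3
    rw [Ideal.supportedSubmodule_sup]
    constructor
    · rintro ⟨y, ⟨hy1, hy2⟩, hy⟩
      -- `u - y` and `v + y` are cocycles with sum `u + v`, and vanishing in the lower degree makes
      -- each a coboundary.
      obtain ⟨p, hp, hdp⟩ := hI (u - y) (Submodule.sub_mem _ h1 hy1) (by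
        rw [map_sub, hy, sub_self])
      obtain ⟨q, hq, hdq⟩ := hJ (v + y) (Submodule.add_mem _ h2 hy2) (by
        rw [map_add, hy, add_comm (d (n + 1) v), h3])
      refine ⟨p + q, Submodule.add_mem _ (hIle _ hp) (hJle _ hq), ?_⟩
      rw [map_add, hdp, hdq]
      abel
    · rintro ⟨y, hy, hdy⟩
      obtain ⟨p, hp, q, hq, rfl⟩ := Ideal.exists_add_eq_of_mem_supportedSubmodule hIK hy
      refine ⟨u - d n p, ⟨Submodule.sub_mem _ h1 (Ideal.map_mem_supportedSubmodule _ hp), ?_⟩, ?_⟩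
      -- The left side is supported in `V(I)`, the right side in `V(J)`.
      · have h4 : u - d n p = d n q - v := by
          rw [map_add] at hdy
          rw [sub_eq_sub_iff_add_eq_add, add_comm (d n q), hdy]
        rw [h4]
        exact Submodule.sub_mem _ (Ideal.map_mem_supportedSubmodule _ hq) h2
      · rw [map_sub, hdd, sub_zero]
  exact ⟨((Submodule.quotEquivOfEq _ _ (by rw [LinearMap.ker_comp, Submodule.ker_mkQ])).trans
      (LinearMap.quotKerEquivOfSurjective
        ((supportedCoboundaries d (I ⊔ J) (n + 1)).mkQ ∘ₗ g)
        ((Submodule.mkQ_surjective _).comp hg))).symm.trans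
    ((Submodule.quotEquivOfEq _ _ hker).trans
      ((Submodule.quotEquivOfEq _ _ (by rw [LinearMap.ker_comp, Submodule.ker_mkQ])).trans
        (LinearMap.quotKerEquivOfSurjective ((supportedCoboundaries d K n).mkQ ∘ₗ f)
          ((Submodule.mkQ_surjective _).comp hf))))⟩

end SupportedCohomology

/-! ### Connecting morphisms between left derived functors. -/

section LeftDerivedConnecting

open Limits

variable {C : Type*} [Category* C] {D : Type*} [Category* D] [Abelian C]
  [Abelian D] {F G H : C ⥤ D} [F.Additive] [G.Additive] [H.Additive]
  (α : F ⟶ G) (β : G ⟶ H) (w : ∀ X, α.app X ≫ β.app X = 0)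

/-- The short complex of chain complexes obtained by applying natural transformations
`F ⟶ G ⟶ H` to a chain complex. -/
@[simps]
noncomputable def CategoryTheory.NatTrans.chainShortComplex (K : ChainComplex C ℕ) :
    ShortComplex (ChainComplex D ℕ) where
  X₁ := (F.mapHomologicalComplex _).obj K
  X₂ := (G.mapHomologicalComplex _).obj K
  X₃ := (H.mapHomologicalComplex _).obj K
  f := (NatTrans.mapHomologicalComplex α _).app K
  g := (NatTrans.mapHomologicalComplex β _).app K
  zero := by
    ext n
    exact w (K.X n)

/-- The functoriality of `NatTrans.chainShortComplex` in the chain complex. -/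
@[simps]
noncomputable def CategoryTheory.NatTrans.chainShortComplexMap {K L : ChainComplex C ℕ}
    (φ : K ⟶ L) : NatTrans.chainShortComplex α β w K ⟶ NatTrans.chainShortComplex α β w L where
  τ₁ := (F.mapHomologicalComplex _).map φ
  τ₂ := (G.mapHomologicalComplex _).map φ
  τ₃ := (H.mapHomologicalComplex _).map φ
  comm₁₂ := (NatTrans.mapHomologicalComplex α _).naturality φ
  comm₂₃ := (NatTrans.mapHomologicalComplex β _).naturality φ

variable (hS : ∀ (P : C) [Projective P], (ShortComplex.mk _ _ (w P)).ShortExact)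

include hS in
theorem CategoryTheory.NatTrans.chainShortComplex_shortExact (K : ChainComplex C ℕ)
    [∀ n, Projective (K.X n)] : (NatTrans.chainShortComplex α β w K).ShortExact :=
  HomologicalComplex.shortExact_of_degreewise_shortExact _ fun n => hS (K.X n)

/-- The connecting morphism in homology attached to `NatTrans.chainShortComplex`. -/
noncomputable def CategoryTheory.NatTrans.chainδ (K : ChainComplex C ℕ)
    [∀ n, Projective (K.X n)] (n : ℕ) :
    (HomologicalComplex.homologyFunctor D (ComplexShape.down ℕ) (n + 1)).obj
      ((H.mapHomologicalComplex _).obj K) ⟶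
    (HomologicalComplex.homologyFunctor D (ComplexShape.down ℕ) n).obj
      ((F.mapHomologicalComplex _).obj K) :=
  (NatTrans.chainShortComplex_shortExact α β w hS K).δ (n + 1) n (by simp)

theorem CategoryTheory.NatTrans.chainδ_naturality {K L : ChainComplex C ℕ}
    [∀ n, Projective (K.X n)] [∀ n, Projective (L.X n)] (φ : K ⟶ L) (n : ℕ) :
    NatTrans.chainδ α β w hS K n ≫
      (F.mapHomologicalComplex _ ⋙ HomologicalComplex.homologyFunctor D _ n).map φ =
    (H.mapHomologicalComplex _ ⋙ HomologicalComplex.homologyFunctor D _ (n + 1)).map φ ≫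
      NatTrans.chainδ α β w hS L n :=
  HomologicalComplex.HomologySequence.δ_naturality (NatTrans.chainShortComplexMap α β w φ)
    (NatTrans.chainShortComplex_shortExact α β w hS K)
    (NatTrans.chainShortComplex_shortExact α β w hS L) (n + 1) n (by simp)

theorem CategoryTheory.NatTrans.chainδ_comp (K : ChainComplex C ℕ)
    [∀ n, Projective (K.X n)] (n : ℕ) :
    NatTrans.chainδ α β w hS K n ≫ (HomologicalComplex.homologyFunctor D _ n).map
      ((NatTrans.mapHomologicalComplex α _).app K) = 0 :=
  (NatTrans.chainShortComplex_shortExact α β w hS K).δ_comp (n + 1) n (by simp)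

theorem CategoryTheory.NatTrans.chainδ_exact (K : ChainComplex C ℕ)
    [∀ n, Projective (K.X n)] (n : ℕ) :
    (ShortComplex.mk _ _ (NatTrans.chainδ_comp α β w hS K n)).Exact :=
  (NatTrans.chainShortComplex_shortExact α β w hS K).homology_exact₁ (n + 1) n (by simp)

theorem CategoryTheory.ProjectiveResolution.opcyclesMap_comp_fromLeftDerivedZero' {X : C}
    (P : ProjectiveResolution X) :
    HomologicalComplex.opcyclesMap ((NatTrans.mapHomologicalComplex α _).app P.complex) 0 ≫
      P.fromLeftDerivedZero' G = P.fromLeftDerivedZero' F ≫ α.app X := by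
  rw [← cancel_epi (HomologicalComplex.pOpcycles _ _), HomologicalComplex.p_opcyclesMap_assoc,
    ProjectiveResolution.pOpcycles_comp_fromLeftDerivedZero',
    ProjectiveResolution.pOpcycles_comp_fromLeftDerivedZero'_assoc]
  exact (α.naturality _).symm

variable [HasProjectiveResolutions C]

/-- The connecting morphism between left derived functors attached to a sequence of functors
`F ⟶ G ⟶ H` which is short exact on projective objects. -/
noncomputable def CategoryTheory.NatTrans.leftDerivedδ (n : ℕ) :
    H.leftDerived (n + 1) ⟶ F.leftDerived n where
  app X := ((projectiveResolution X).isoLeftDerivedObj H (n + 1)).hom ≫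
    NatTrans.chainδ α β w hS (projectiveResolution X).complex n ≫
      ((projectiveResolution X).isoLeftDerivedObj F n).inv
  naturality X Y f := by
    have comm : (ProjectiveResolution.lift f (projectiveResolution X)
      (projectiveResolution Y)).f 0 ≫ (projectiveResolution Y).π.f 0 =
        (projectiveResolution X).π.f 0 ≫ f := ProjectiveResolution.lift_commutes_zero _ _ _
    rw [ProjectiveResolution.isoLeftDerivedObj_hom_naturality_assoc f _ _ _ comm H (n + 1),
      Category.assoc, Category.assoc,
      ProjectiveResolution.isoLeftDerivedObj_inv_naturality f _ _ _ comm F n,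
      ← reassoc_of% (NatTrans.chainδ_naturality α β w hS)]
    rfl

theorem CategoryTheory.NatTrans.isIso_leftDerivedδ (n : ℕ)
    (h₀ : ∀ X, IsZero ((G.leftDerived n).obj X))
    (h₁ : ∀ X, IsZero ((G.leftDerived (n + 1)).obj X)) :
    IsIso (NatTrans.leftDerivedδ α β w hS n) := by
  have (X : C) : IsIso ((NatTrans.leftDerivedδ α β w hS n).app X) := by
    have : IsIso (NatTrans.chainδ α β w hS (projectiveResolution X).complex n) :=
      (NatTrans.chainShortComplex_shortExact α β w hS
        (projectiveResolution X).complex).isIso_δ (n + 1) n (by simp)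
        ((h₁ X).of_iso ((projectiveResolution X).isoLeftDerivedObj G (n + 1)).symm)
        ((h₀ X).of_iso ((projectiveResolution X).isoLeftDerivedObj G n).symm)
    dsimp only [NatTrans.leftDerivedδ]
    infer_instance
  exact NatIso.isIso_of_isIso_app _

theorem CategoryTheory.NatTrans.mono_leftDerivedδ_app (n : ℕ) (X : C)
    (h₁ : IsZero ((G.leftDerived (n + 1)).obj X)) :
    Mono ((NatTrans.leftDerivedδ α β w hS n).app X) := by
  have : Mono (NatTrans.chainδ α β w hS (projectiveResolution X).complex n) :=
    (NatTrans.chainShortComplex_shortExact α β w hS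
      (projectiveResolution X).complex).mono_δ (n + 1) n (by simp)
      (h₁.of_iso ((projectiveResolution X).isoLeftDerivedObj G (n + 1)).symm)
  dsimp only [NatTrans.leftDerivedδ]
  infer_instance

theorem CategoryTheory.NatTrans.leftDerivedδ_app_comp (n : ℕ) (X : C) :
    (NatTrans.leftDerivedδ α β w hS n).app X ≫ (NatTrans.leftDerived α n).app X = 0 := by
  rw [ProjectiveResolution.leftDerived_app_eq α (projectiveResolution X)]
  simp only [NatTrans.leftDerivedδ, Category.assoc]
  rw [Iso.inv_hom_id_assoc, reassoc_of% (NatTrans.chainδ_comp α β w hS), Limits.zero_comp,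
    Limits.comp_zero]

theorem CategoryTheory.NatTrans.leftDerivedδ_exact (n : ℕ) (X : C) :
    (ShortComplex.mk _ _ (NatTrans.leftDerivedδ_app_comp α β w hS n X)).Exact := by
  let P := projectiveResolution X
  refine ShortComplex.exact_of_iso ?_ (NatTrans.chainδ_exact α β w hS P.complex n)
  refine ShortComplex.isoMk (P.isoLeftDerivedObj H (n + 1)).symm (P.isoLeftDerivedObj F n).symm
    (P.isoLeftDerivedObj G n).symm ?_ ?_
  · dsimp only [NatTrans.leftDerivedδ, Iso.symm_hom]
    rw [Iso.inv_hom_id_assoc]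
  · dsimp only [Iso.symm_hom]
    rw [ProjectiveResolution.leftDerived_app_eq α P, Iso.inv_hom_id_assoc]

theorem CategoryTheory.NatTrans.leftDerived_zero_app_comp_fromLeftDerivedZero (X : C) :
    (NatTrans.leftDerived α 0).app X ≫ G.fromLeftDerivedZero.app X =
      F.fromLeftDerivedZero.app X ≫ α.app X := by
  let P := projectiveResolution X
  have h : (HomologicalComplex.homologyFunctor D _ 0).map
      ((NatTrans.mapHomologicalComplex α _).app P.complex) ≫
      (ChainComplex.isoHomologyι₀ _).hom ≫ P.fromLeftDerivedZero' G =
      ((ChainComplex.isoHomologyι₀ _).hom ≫ P.fromLeftDerivedZero' F) ≫ α.app X := by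
    rw [Category.assoc, ← P.opcyclesMap_comp_fromLeftDerivedZero' α]
    exact HomologicalComplex.homologyι_naturality_assoc
      ((NatTrans.mapHomologicalComplex α _).app P.complex) 0 _
  rw [ProjectiveResolution.leftDerived_app_eq α P, P.fromLeftDerivedZero_eq F,
    P.fromLeftDerivedZero_eq G, Category.assoc, Category.assoc, Category.assoc]
  erw [Iso.inv_hom_id_assoc, h]
  rfl

/-- The composition of the connecting morphism in degree one with `F.fromLeftDerivedZero`. -/
noncomputable def CategoryTheory.NatTrans.leftDerivedOneδ : H.leftDerived 1 ⟶ F :=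
  NatTrans.leftDerivedδ α β w hS 0 ≫ F.fromLeftDerivedZero

theorem CategoryTheory.NatTrans.leftDerivedOneδ_app_comp (X : C) :
    (NatTrans.leftDerivedOneδ α β w hS).app X ≫ α.app X = 0 := by
  rw [NatTrans.leftDerivedOneδ, NatTrans.comp_app, Category.assoc,
    ← NatTrans.leftDerived_zero_app_comp_fromLeftDerivedZero,
    reassoc_of% (NatTrans.leftDerivedδ_app_comp α β w hS 0 X), Limits.zero_comp]

theorem CategoryTheory.NatTrans.leftDerivedOneδ_exact [PreservesFiniteColimits F]
    [PreservesFiniteColimits G] (X : C) :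
    (ShortComplex.mk _ _ (NatTrans.leftDerivedOneδ_app_comp α β w hS X)).Exact := by
  refine ShortComplex.exact_of_iso ?_ (NatTrans.leftDerivedδ_exact α β w hS 0 X)
  refine ShortComplex.isoMk (Iso.refl _) (asIso (F.fromLeftDerivedZero.app X))
    (asIso (G.fromLeftDerivedZero.app X)) ?_ ?_
  · dsimp only [NatTrans.leftDerivedOneδ, Iso.refl_hom, asIso_hom, NatTrans.comp_app]
    rw [Category.id_comp]
  · exact (NatTrans.leftDerived_zero_app_comp_fromLeftDerivedZero α X).symm

theorem CategoryTheory.NatTrans.mono_leftDerivedOneδ_app [PreservesFiniteColimits F] (X : C)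
    (h₁ : IsZero ((G.leftDerived 1).obj X)) :
    Mono ((NatTrans.leftDerivedOneδ α β w hS).app X) := by
  have := NatTrans.mono_leftDerivedδ_app α β w hS 0 X h₁
  rw [NatTrans.leftDerivedOneδ, NatTrans.comp_app]
  infer_instance

end LeftDerivedConnecting

/-! ### Dimension shifting for `Ext` in the second variable. -/

section ExtShift

open Limits Opposite

/-- The isomorphism between the opposites of isomorphic functors with values in an opposite
category. -/
@[simps]
def CategoryTheory.Iso.leftOpIso {C D : Type*} [Category* C] [Category* D] {F G : C ⥤ Dᵒᵖ}
    (e : F ≅ G) : F.leftOp ≅ G.leftOp where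
  hom := NatTrans.leftOp e.inv
  inv := NatTrans.leftOp e.hom
  hom_inv_id := by rw [← NatTrans.leftOp_comp, e.hom_inv_id, NatTrans.leftOp_id]
  inv_hom_id := by rw [← NatTrans.leftOp_comp, e.inv_hom_id, NatTrans.leftOp_id]

variable {R : Type u} [CommRing R]

instance linearYoneda_obj_preservesFiniteLimits (Y : ModuleCat.{u} R) :
    PreservesFiniteLimits ((linearYoneda R (ModuleCat.{u} R)).obj Y) :=
  have : PreservesFiniteLimits ((linearYoneda R (ModuleCat.{u} R)).obj Y ⋙ forget _) :=
    inferInstanceAs (PreservesFiniteLimits (yoneda.obj Y))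
  preservesFiniteLimits_of_reflects_of_preserves _ (forget (ModuleCat.{u} R))

instance linearYoneda_obj_rightOp_preservesFiniteColimits (Y : ModuleCat.{u} R) :
    PreservesFiniteColimits ((linearYoneda R (ModuleCat.{u} R)).obj Y).rightOp :=
  preservesFiniteColimits_rightOp _

variable {S : ShortComplex (ModuleCat.{u} R)}

theorem linearYoneda_rightOp_comp (S : ShortComplex (ModuleCat.{u} R)) (X : ModuleCat.{u} R) :
    (NatTrans.rightOp ((linearYoneda R (ModuleCat.{u} R)).map S.g)).app X ≫
      (NatTrans.rightOp ((linearYoneda R (ModuleCat.{u} R)).map S.f)).app X = 0 := by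
  apply Quiver.Hom.unop_inj
  ext φ : 2
  have h (ψ : X ⟶ S.X₁) : (ψ ≫ S.f) ≫ S.g = 0 := by
    rw [Category.assoc, S.zero, comp_zero]
  exact h φ

/-- `Ext` is here left derived in its first variable, with values in the opposite category. Hence
`F`, `G`, `H` of the preceding section are `Hom(-, X₃)`, `Hom(-, X₂)`, `Hom(-, X₁)`, in that order.
-/
theorem linearYoneda_rightOp_shortExact (hS : S.ShortExact) (P : ModuleCat.{u} R)
    [Projective P] : (ShortComplex.mk _ _ (linearYoneda_rightOp_comp S P)).ShortExact := by
  let T : ShortComplex (ModuleCat.{u} R) :=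
    ShortComplex.mk (((linearYoneda R (ModuleCat.{u} R)).map S.f).app (op P))
      (((linearYoneda R (ModuleCat.{u} R)).map S.g).app (op P))
      (congrArg Quiver.Hom.unop (linearYoneda_rightOp_comp S P))
  have hT : T.ShortExact := by
    have := hS.mono_f
    have := hS.epi_g
    refine { exact := ?_, mono_f := ?_, epi_g := ?_ }
    · rw [ShortComplex.moduleCat_exact_iff]
      intro φ hφ
      exact ⟨hS.exact.lift φ hφ, hS.exact.lift_f φ hφ⟩
    · rw [ModuleCat.mono_iff_injective]
      intro φ ψ h
      exact (cancel_mono S.f).mp h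
    · rw [ModuleCat.epi_iff_surjective]
      intro φ
      exact ⟨Projective.factorThru φ S.g, Projective.factorThru_comp φ S.g⟩
  exact hT.op

theorem isZero_linearYoneda_leftDerived_succ (Y : ModuleCat.{u} R) [Injective Y] (n : ℕ)
    (X : ModuleCat.{u} R) :
    IsZero ((((linearYoneda R (ModuleCat.{u} R)).obj Y).rightOp.leftDerived (n + 1)).obj X) := by
  let P := projectiveResolution X
  let F := ((linearYoneda R (ModuleCat.{u} R)).obj Y).rightOp
  refine IsZero.of_iso ?_ (P.isoLeftDerivedObj F (n + 1))
  refine ((HomologicalComplex.exactAt_iff_isZero_homology _ _).mp ?_)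
  rw [HomologicalComplex.exactAt_iff' _ (n + 2) (n + 1) n (by simp) (by simp),
    ← ShortComplex.exact_unop_iff, ShortComplex.moduleCat_exact_iff]
  intro φ hφ
  exact ⟨(P.exact_succ n).descToInjective φ hφ, (P.exact_succ n).comp_descToInjective φ hφ⟩

/-- The degree shift for `Ext` along a short exact sequence with injective middle term. -/
noncomputable def extFlipShiftIso (hS : S.ShortExact) [Injective S.X₂] (n : ℕ) :
    (Ext R (ModuleCat.{u} R) (n + 2)).flip.obj S.X₁ ≅
      (Ext R (ModuleCat.{u} R) (n + 1)).flip.obj S.X₃ :=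
  have := NatTrans.isIso_leftDerivedδ _ _ (linearYoneda_rightOp_comp S)
    (linearYoneda_rightOp_shortExact hS) (n + 1)
    (isZero_linearYoneda_leftDerived_succ S.X₂ n)
    (isZero_linearYoneda_leftDerived_succ S.X₂ (n + 1))
  (asIso (NatTrans.leftDerivedδ _ _ (linearYoneda_rightOp_comp S)
    (linearYoneda_rightOp_shortExact hS) (n + 1))).leftOpIso

/-- The connecting morphism from `Hom` to `Ext¹`. -/
noncomputable def extOneδ (hS : S.ShortExact) :
    (linearYoneda R (ModuleCat.{u} R)).obj S.X₃ ⟶ (Ext R (ModuleCat.{u} R) 1).flip.obj S.X₁ :=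
  NatTrans.leftOp (NatTrans.leftDerivedOneδ _ _ (linearYoneda_rightOp_comp S)
    (linearYoneda_rightOp_shortExact hS))

theorem extOneδ_surjective (hS : S.ShortExact) [Injective S.X₂] (X : (ModuleCat.{u} R)ᵒᵖ) :
    Function.Surjective ((extOneδ hS).app X) := by
  rw [← ModuleCat.epi_iff_surjective]
  have := NatTrans.mono_leftDerivedOneδ_app _ _ (linearYoneda_rightOp_comp S)
    (linearYoneda_rightOp_shortExact hS) X.unop
    (isZero_linearYoneda_leftDerived_succ S.X₂ 0 X.unop)
  exact inferInstanceAs (Epi ((NatTrans.leftDerivedOneδ _ _ (linearYoneda_rightOp_comp S)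
    (linearYoneda_rightOp_shortExact hS)).app X.unop).unop)

theorem extOneδ_comp (hS : S.ShortExact) (X : ModuleCat.{u} R) :
    ((linearYoneda R (ModuleCat.{u} R)).map S.g).app (op X) ≫ (extOneδ hS).app (op X) = 0 :=
  congrArg Quiver.Hom.unop (NatTrans.leftDerivedOneδ_app_comp _ _ (linearYoneda_rightOp_comp S)
    (linearYoneda_rightOp_shortExact hS) X)

theorem extOneδ_exact (hS : S.ShortExact) (X : ModuleCat.{u} R) :
    (ShortComplex.mk _ _ (extOneδ_comp hS X)).Exact :=
  (NatTrans.leftDerivedOneδ_exact _ _ (linearYoneda_rightOp_comp S)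
    (linearYoneda_rightOp_shortExact hS) X).unop

theorem ModuleCat.exact_apply_eq_zero_iff {A B C : ModuleCat.{u} R} {f : A ⟶ B} {g : B ⟶ C}
    {w : f ≫ g = 0} (h : (ShortComplex.mk f g w).Exact) (x : B) :
    g x = 0 ↔ ∃ y : A, f y = x :=
  ⟨(ShortComplex.moduleCat_exact_iff _).mp h x, by
    rintro ⟨y, rfl⟩
    exact ConcreteCategory.congr_hom w y⟩

theorem extOneδ_apply_eq_zero_iff (hS : S.ShortExact) {X : ModuleCat.{u} R}
    (φ : ((linearYoneda R (ModuleCat.{u} R)).obj S.X₃).obj (op X)) :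
    (extOneδ hS).app (op X) φ = 0 ↔ ∃ ψ : X ⟶ S.X₂, ψ ≫ S.g = φ :=
  ModuleCat.exact_apply_eq_zero_iff (extOneδ_exact hS X) φ

end ExtShift

/-! ### Dimension shifting for local cohomology, and its degree one. -/

section LocalCohomologyShift

open Limits Opposite

variable {R : Type u} [CommRing R]

namespace localCohomology

/-- The directed system of the modules `Ext^n(R/I^t, M)`. -/
noncomputable abbrev extSystem (I : Ideal R) (n : ℕ) (M : ModuleCat.{u} R) :
    ℕᵒᵖᵒᵖ ⥤ ModuleCat.{u} R :=
  (ringModIdeals (idealPowersDiagram I)).op ⋙ (Ext R (ModuleCat.{u} R) n).flip.obj M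

/-- Local cohomology of `M` as the direct limit of the modules `Ext^n(R/I^t, M)`. -/
noncomputable def objIsoColimit (I : Ideal R) (n : ℕ) (M : ModuleCat.{u} R) :
    (localCohomology I n).obj M ≅ colimit (extSystem I n M) :=
  colimitObjIsoColimitCompEvaluation (diagram (idealPowersDiagram I) n) M

/-- The degree shift for local cohomology along a short exact sequence with injective middle
term. -/
noncomputable def shiftIso (I : Ideal R) {S : ShortComplex (ModuleCat.{u} R)} (hS : S.ShortExact)
    [Injective S.X₂] (n : ℕ) :
    (localCohomology I (n + 2)).obj S.X₁ ≅ (localCohomology I (n + 1)).obj S.X₃ :=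
  objIsoColimit I (n + 2) S.X₁ ≪≫
    HasColimit.isoOfNatIso (Functor.isoWhiskerLeft _ (extFlipShiftIso hS n)) ≪≫
      (objIsoColimit I (n + 1) S.X₃).symm

/-- The morphism from `R/I^t` determined by an element killed by `I^t`. -/
noncomputable def homOfLeTorsionOf (I : Ideal R) {N : ModuleCat.{u} R} (z : N)
    (j : ℕᵒᵖᵒᵖ) (hz : I ^ j.unop.unop ≤ Ideal.torsionOf R N z) :
    (ringModIdeals (idealPowersDiagram I)).obj j.unop ⟶ N :=
  ModuleCat.ofHom (Submodule.liftQ _ (LinearMap.toSpanSingleton R N z) hz)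

/-- The class of `1` in `R/I^t`. -/
def oneMk (I : Ideal R) (j : ℕᵒᵖᵒᵖ) :
    (ringModIdeals (idealPowersDiagram I)).obj j.unop :=
  Submodule.Quotient.mk (p := I ^ j.unop.unop) (1 : R)

theorem homOfLeTorsionOf_oneMk (I : Ideal R) {N : ModuleCat.{u} R} (z : N)
    (j : ℕᵒᵖᵒᵖ) (hz : I ^ j.unop.unop ≤ Ideal.torsionOf R N z) :
    homOfLeTorsionOf I z j hz (oneMk I j) = z :=
  one_smul R z

theorem hom_ext_oneMk (I : Ideal R) {N : ModuleCat.{u} R} {j : ℕᵒᵖᵒᵖ}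
    {φ ψ : (ringModIdeals (idealPowersDiagram I)).obj j.unop ⟶ N}
    (h : φ (oneMk I j) = ψ (oneMk I j)) : φ = ψ := by
  apply ModuleCat.hom_ext
  refine Submodule.linearMap_qext (I ^ j.unop.unop) (LinearMap.ext_ring ?_)
  exact h

/-- Evaluation at the class of `1`, as a map to the elements supported in `V(I)`. -/
def evalOneMk (I : Ideal R) (N : ModuleCat.{u} R) (j : ℕᵒᵖᵒᵖ) :
    ((linearYoneda R (ModuleCat.{u} R)).obj N).obj
      (op ((ringModIdeals (idealPowersDiagram I)).obj j.unop)) →ₗ[R] I.supportedSubmodule N where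
  toFun φ := ⟨ModuleCat.Hom.hom φ (oneMk I j), by
    apply Ideal.mem_supportedSubmodule_of_pow_le (k := j.unop.unop)
    intro r hr
    rw [Ideal.mem_torsionOf_iff, ← map_smul]
    have : r • oneMk I j = 0 := by
      refine (Submodule.Quotient.mk_eq_zero (I ^ j.unop.unop)).mpr ?_
      simpa using hr
    rw [this, map_zero]⟩
  map_add' _ _ := rfl
  map_smul' _ _ := rfl

variable {S : ShortComplex (ModuleCat.{u} R)} (hS : S.ShortExact)
  {Q : Type u} [AddCommGroup Q] [Module R Q] (I : Ideal R)
  (q : I.supportedSubmodule S.X₃ →ₗ[R] Q)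
  (hq : ∀ z, q z = 0 ↔ ∃ e ∈ I.supportedSubmodule S.X₂, S.g e = z)

include hq in
theorem ker_extOneδ_le (j : ℕᵒᵖᵒᵖ) :
    LinearMap.ker ((extOneδ hS).app (op ((ringModIdeals (idealPowersDiagram I)).obj j.unop))).hom ≤
      LinearMap.ker (q ∘ₗ evalOneMk I S.X₃ j) := by
  intro φ hφ
  obtain ⟨ψ, rfl⟩ := (extOneδ_apply_eq_zero_iff hS φ).mp hφ
  exact (hq _).mpr ⟨_, (evalOneMk I S.X₂ j ψ).2, rfl⟩

theorem extSystem_map_extOneδ {j k : ℕᵒᵖᵒᵖ} (f : j ⟶ k)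
    (φ : ((linearYoneda R (ModuleCat.{u} R)).obj S.X₃).obj
      (op ((ringModIdeals (idealPowersDiagram I)).obj j.unop))) :
    (extSystem I 1 S.X₁).map f ((extOneδ hS).app _ φ) =
      (extOneδ hS).app (op ((ringModIdeals (idealPowersDiagram I)).obj k.unop))
        (((linearYoneda R (ModuleCat.{u} R)).obj S.X₃).map
          ((ringModIdeals (idealPowersDiagram I)).map f.unop).op φ) :=
  (ConcreteCategory.congr_hom ((extOneδ hS).naturality
    ((ringModIdeals (idealPowersDiagram I)).map f.unop).op) φ).symm

variable [Injective S.X₂]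

/-- The map from `Ext¹(R/I^t, M)` to the cokernel on elements supported in `V(I)`. -/
noncomputable def extOneDesc (j : ℕᵒᵖᵒᵖ) : (extSystem I 1 S.X₁).obj j →ₗ[R] Q :=
  (Submodule.liftQ _ (q ∘ₗ evalOneMk I S.X₃ j) (ker_extOneδ_le hS I q hq j)) ∘ₗ
    (LinearMap.quotKerEquivOfSurjective _ (extOneδ_surjective hS _)).symm.toLinearMap

theorem extOneDesc_apply (j : ℕᵒᵖᵒᵖ)
    (φ : ((linearYoneda R (ModuleCat.{u} R)).obj S.X₃).obj
      (op ((ringModIdeals (idealPowersDiagram I)).obj j.unop))) :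
    extOneDesc hS I q hq j ((extOneδ hS).app _ φ) = q (evalOneMk I S.X₃ j φ) := by
  have h : (LinearMap.quotKerEquivOfSurjective _ (extOneδ_surjective hS
      (op ((ringModIdeals (idealPowersDiagram I)).obj j.unop)))).symm
      ((extOneδ hS).app _ φ) = Submodule.Quotient.mk φ := by
    rw [LinearEquiv.symm_apply_eq]
    rfl
  exact (congrArg _ h).trans rfl

/-- The cocone over the modules `Ext¹(R/I^t, M)` given by `extOneDesc`. -/
@[simps]
noncomputable def extOneCocone : Cocone (extSystem I 1 S.X₁) where
  pt := ModuleCat.of R Q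
  ι :=
    { app j := ModuleCat.ofHom (extOneDesc hS I q hq j)
      naturality j k f := by
        ext x
        obtain ⟨φ, rfl⟩ := extOneδ_surjective hS _ x
        change extOneDesc hS I q hq k ((extSystem I 1 S.X₁).map f ((extOneδ hS).app _ φ)) =
          extOneDesc hS I q hq j ((extOneδ hS).app _ φ)
        rw [extSystem_map_extOneδ, extOneDesc_apply]
        exact extOneDesc_apply hS I q hq k _ }

theorem ι_desc_extOneCocone_apply (j : ℕᵒᵖᵒᵖ)
    (φ : ((linearYoneda R (ModuleCat.{u} R)).obj S.X₃).obj
      (op ((ringModIdeals (idealPowersDiagram I)).obj j.unop))) :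
    colimit.desc _ (extOneCocone hS I q hq) (colimit.ι (extSystem I 1 S.X₁) j
      ((extOneδ hS).app _ φ)) = q (evalOneMk I S.X₃ j φ) :=
  (ConcreteCategory.congr_hom (colimit.ι_desc (extOneCocone hS I q hq) j) _).trans
    (extOneDesc_apply hS I q hq j φ)

variable [IsNoetherianRing R]

include hS hq in
/-- The first local cohomology of `M` is the cokernel on elements supported in `V(I)` of the
surjection in a short exact sequence starting in `M` with injective middle term. -/
theorem nonempty_one_iso (hq' : Function.Surjective q) :
    Nonempty ((localCohomology I 1).obj S.X₁ ≅ ModuleCat.of R Q) := by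
  have : PreservesFilteredColimitsOfSize.{0, 0} (forget (ModuleCat.{u} R)) :=
    preservesSmallestFilteredColimits_of_preservesFilteredColimits _
  have hbij : Function.Bijective
      (colimit.desc (extSystem I 1 S.X₁) (extOneCocone hS I q hq)).hom := by
    constructor
    · rw [← LinearMap.ker_eq_bot, LinearMap.ker_eq_bot']
      intro x hx
      obtain ⟨j, y, rfl⟩ := Concrete.colimit_exists_rep (extSystem I 1 S.X₁) x
      obtain ⟨φ, rfl⟩ := extOneδ_surjective hS _ y
      have hx' := (ι_desc_extOneCocone_apply hS I q hq j φ).symm.trans hx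
      obtain ⟨e, he, hge⟩ := (hq _).mp hx'
      obtain ⟨s, hs⟩ := Ideal.mem_supportedSubmodule_iff_exists_pow.mp he
      -- From this stage on `e` defines a map out of `R/I^k` lifting `φ` to the injective middle
      -- term, so the class of `φ` in `Ext¹` dies.
      let k : ℕᵒᵖᵒᵖ := op (op (max j.unop.unop s))
      let f : j ⟶ k := (homOfLE (le_max_left j.unop.unop s)).op.op
      rw [← colimit.w (extSystem I 1 S.X₁) f]
      change colimit.ι (extSystem I 1 S.X₁) k
        ((extSystem I 1 S.X₁).map f ((extOneδ hS).app _ φ)) = 0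
      rw [extSystem_map_extOneδ, (extOneδ_apply_eq_zero_iff hS _).mpr, map_zero]
      refine ⟨homOfLeTorsionOf I e k ((Ideal.pow_le_pow_right (le_max_right _ _)).trans hs), ?_⟩
      apply hom_ext_oneMk I
      refine Eq.trans ?_ hge
      exact congrArg S.g (homOfLeTorsionOf_oneMk I e k _)
    · intro y
      obtain ⟨z, rfl⟩ := hq' y
      obtain ⟨t, ht⟩ := Ideal.mem_supportedSubmodule_iff_exists_pow.mp z.2
      refine ⟨colimit.ι (extSystem I 1 S.X₁) (op (op t)) ((extOneδ hS).app _
        (homOfLeTorsionOf I (z : S.X₃) (op (op t)) ht)), ?_⟩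
      refine (ι_desc_extOneCocone_apply hS I q hq (op (op t)) _).trans (congrArg q ?_)
      exact Subtype.ext (homOfLeTorsionOf_oneMk I _ _ ht)
  exact ⟨objIsoColimit I 1 S.X₁ ≪≫ (LinearEquiv.ofBijective _ hbij).toModuleIso⟩

end localCohomology

end LocalCohomologyShift

/-! ### An injective resolution, and lowering the degree by one. -/

section InjectiveChain

open Limits

variable {R : Type u} [CommRing R] (M : ModuleCat.{u} R)

/-- The cosyzygies of `M` in its functorial injective resolution. -/
noncomputable def cosyzygy : ℕ → ModuleCat.{u} R
  | 0 => M
  | k + 1 => cokernel (Injective.ι (cosyzygy k))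

/-- The short exact sequence relating consecutive cosyzygies. -/
@[simps]
noncomputable def cosyzygyShortComplex (k : ℕ) : ShortComplex (ModuleCat.{u} R) where
  X₁ := cosyzygy M k
  X₂ := Injective.under (cosyzygy M k)
  X₃ := cosyzygy M (k + 1)
  f := Injective.ι (cosyzygy M k)
  g := cokernel.π (Injective.ι (cosyzygy M k))
  zero := cokernel.condition _

theorem cosyzygyShortComplex_shortExact (k : ℕ) : (cosyzygyShortComplex M k).ShortExact where
  exact := ShortComplex.exact_cokernel _
  mono_f := inferInstanceAs (Mono (Injective.ι (cosyzygy M k)))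
  epi_g := inferInstanceAs (Epi (cokernel.π (Injective.ι (cosyzygy M k))))

instance (k : ℕ) : Injective (cosyzygyShortComplex M k).X₂ :=
  inferInstanceAs (Injective (Injective.under (cosyzygy M k)))

/-- The terms of an injective resolution of `M`. -/
noncomputable abbrev injectiveTerm (k : ℕ) : Type u :=
  (Injective.under (cosyzygy M k) : ModuleCat.{u} R)

instance (k : ℕ) : Module.Injective R (injectiveTerm M k) :=
  (Module.injective_iff_injective_object R _).mpr
    (inferInstanceAs (Injective (Injective.under (cosyzygy M k) : ModuleCat.{u} R)))

/-- The differentials of an injective resolution of `M`. -/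
noncomputable def injectiveD (k : ℕ) : injectiveTerm M k →ₗ[R] injectiveTerm M (k + 1) :=
  (Injective.ι (cosyzygy M (k + 1))).hom ∘ₗ (cosyzygyShortComplex M k).g.hom

theorem injective_ι_cosyzygy (k : ℕ) :
    Function.Injective (Injective.ι (cosyzygy M k)).hom :=
  (ModuleCat.mono_iff_injective _).mp inferInstance

theorem injectiveD_eq_zero_iff (k : ℕ) (x : injectiveTerm M k) :
    injectiveD M k x = 0 ↔ ∃ y : cosyzygy M k, Injective.ι (cosyzygy M k) y = x := by
  have h := ModuleCat.exact_apply_eq_zero_iff (cosyzygyShortComplex_shortExact M k).exact x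
  refine Iff.trans ?_ h
  exact map_eq_zero_iff _ (injective_ι_cosyzygy M (k + 1))

theorem injectiveD_exact (k : ℕ) : Function.Exact (injectiveD M k) (injectiveD M (k + 1)) := by
  intro x
  rw [injectiveD_eq_zero_iff]
  have hepi := (ModuleCat.epi_iff_surjective _).mp (cosyzygyShortComplex_shortExact M k).epi_g
  constructor
  · rintro ⟨y, rfl⟩
    obtain ⟨z, rfl⟩ := hepi y
    exact ⟨z, rfl⟩
  · rintro ⟨z, rfl⟩
    exact ⟨_, rfl⟩

/-- The elements of a cosyzygy supported in `V(I)` are the cocycles supported in `V(I)`. -/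
noncomputable def cosyzygyToCocycles (I : Ideal R) (n : ℕ) :
    I.supportedSubmodule (cosyzygy M (n + 1)) →ₗ[R] supportedCocycles (injectiveD M) I n :=
  ((Injective.ι (cosyzygy M (n + 1))).hom ∘ₗ Submodule.subtype _).codRestrict _ fun z =>
    ⟨Ideal.map_mem_supportedSubmodule (Injective.ι (cosyzygy M (n + 1))).hom z.2,
      (injectiveD_eq_zero_iff M (n + 1) _).mpr ⟨z, rfl⟩⟩

theorem cosyzygyToCocycles_surjective (I : Ideal R) (n : ℕ) :
    Function.Surjective (cosyzygyToCocycles M I n) := by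
  rintro ⟨x, hx, hdx⟩
  obtain ⟨y, rfl⟩ := (injectiveD_eq_zero_iff M (n + 1) x).mp hdx
  exact ⟨⟨y, Ideal.mem_supportedSubmodule_of_map _ (injective_ι_cosyzygy M (n + 1)) hx⟩, rfl⟩

namespace localCohomology

theorem nonempty_cosyzygy_iso (I : Ideal R) (n k : ℕ) :
    Nonempty ((localCohomology I (n + 1)).obj (cosyzygy M k) ≅
      (localCohomology I 1).obj (cosyzygy M (k + n))) := by
  induction n generalizing k with
  | zero => exact ⟨Iso.refl _⟩
  | succ n ih =>
    obtain ⟨e⟩ := ih (k + 1)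
    refine ⟨shiftIso I (cosyzygyShortComplex_shortExact M k) n ≪≫ e ≪≫ eqToIso ?_⟩
    rw [Nat.add_right_comm, Nat.add_assoc]

/-- Local cohomology is the cohomology of the elements supported in `V(I)` in an injective
resolution. -/
theorem nonempty_iso_supportedCohomology [IsNoetherianRing R] (I : Ideal R) (n : ℕ) :
    Nonempty ((localCohomology I (n + 1)).obj M ≅
      ModuleCat.of R (SupportedCohomology (injectiveD M) I n)) := by
  -- Shift down to degree one of the `n`-th cosyzygy, where local cohomology is the cokernel of the
  -- torsion of the `n`-th injective term in that of the next cosyzygy. The latter torsion is the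
  -- module of supported cocycles.
  obtain ⟨e₁⟩ := nonempty_cosyzygy_iso M I n 0
  rw [Nat.zero_add] at e₁
  obtain ⟨e₂⟩ := nonempty_one_iso (cosyzygyShortComplex_shortExact M n) I
    ((supportedCoboundaries (injectiveD M) I n).mkQ ∘ₗ cosyzygyToCocycles M I n) (by
      intro z
      refine (Submodule.Quotient.mk_eq_zero (supportedCoboundaries (injectiveD M) I n)).trans ?_
      refine exists_congr fun e => and_congr_right fun _ => ?_
      exact (injective_ι_cosyzygy M (n + 1)).eq_iff)
    ((Submodule.mkQ_surjective _).comp (cosyzygyToCocycles_surjective M I n))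
  exact ⟨e₁ ≪≫ e₂⟩

variable [IsNoetherianRing R]

theorem nonempty_iso_of_generators (n : ℕ) (s t : Finset R) (hs : s.card ≤ n) (ht : t.card ≤ n)
    {J : Ideal R} (hJ : J ≤ Ideal.span (s : Set R) * Ideal.span (t : Set R))
    (hJ' : Ideal.span (s : Set R) * Ideal.span (t : Set R) ≤ J.radical) :
    Nonempty ((localCohomology (Ideal.span (s : Set R) ⊔ Ideal.span (t : Set R)) (n + 2)).obj M ≅
      (localCohomology J (n + 1)).obj M) := by
  obtain ⟨e₁⟩ := nonempty_iso_supportedCohomology M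
    (Ideal.span (s : Set R) ⊔ Ideal.span (t : Set R)) (n + 1)
  obtain ⟨e₂⟩ := nonempty_iso_supportedCohomology M J n
  have hd := injectiveD_exact M
  obtain ⟨e⟩ := nonempty_supportedCohomology_equiv (injectiveD M) hd hJ hJ'
    (supportedExactAt_span _ hd s n hs) (supportedExactAt_span _ hd t n ht)
    (supportedExactAt_span _ hd s (n + 1) (by omega))
    (supportedExactAt_span _ hd t (n + 1) (by omega))
  exact ⟨e₁ ≪≫ e.toModuleIso ≪≫ e₂.symm⟩

/-- An ideal with `n + 1` generators can be replaced by one with `n` generators when lowering the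
cohomological degree from `n + 1` to `n`, for `3 ≤ n`. -/
theorem exists_lower_degree (n : ℕ) (hn : 3 ≤ n) (s : Finset R) (hs : s.card ≤ n + 1) :
    ∃ t : Finset R, t.card ≤ n ∧
      Nonempty ((localCohomology (Ideal.span (s : Set R)) (n + 1)).obj M ≅
        (localCohomology (Ideal.span (t : Set R)) n).obj M) := by
  classical
  obtain ⟨n, rfl⟩ : ∃ m, n = m + 1 := ⟨n - 1, by omega⟩
  -- After the shift `s` has at most `n + 2` elements and `2 ≤ n`. Removing two leaves at most `n`,
  -- so vanishing applies to both parts; removing only one could leave `n + 1`.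
  obtain ⟨a, has, ha⟩ := Finset.exists_subset_card_eq (min_le_right 2 s.card)
  have hb : (s \ a).card ≤ n := by
    rw [Finset.card_sdiff_of_subset has]
    omega
  obtain ⟨t, ht, hle, hle'⟩ := Ideal.exists_span_radical_eq_mul a (s \ a)
  refine ⟨t, by omega, ?_⟩
  have hspan : Ideal.span (s : Set R) = Ideal.span (a : Set R) ⊔ Ideal.span (↑(s \ a) : Set R) := by
    rw [← Ideal.span_union, ← Finset.coe_union, Finset.union_sdiff_of_subset has]
  rw [hspan]
  exact nonempty_iso_of_generators M n a (s \ a) (by omega) hb hle hle'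

end localCohomology

end InjectiveChain

/-! ### Descent to degree three. -/

theorem mainTheorem5 {R : Type u} [CommRing R] [IsNoetherianRing R] (n : ℕ) (hn : 4 ≤ n)
    (I : Ideal R) (hI : ∃ s : Finset R, s.card ≤ n ∧ Ideal.span (s : Set R) = I)
    (M : ModuleCat.{u} R) :
    ∃ J : Ideal R, (∃ t : Finset R, t.card ≤ 3 ∧ Ideal.span (t : Set R) = J) ∧
      Nonempty ((localCohomology I n).obj M ≅ (localCohomology J 3).obj M) := by
  obtain ⟨s, hs, rfl⟩ := hI
  have hn' : 3 ≤ n := by omega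
  induction n, hn' using Nat.le_induction generalizing s with
  | base => exact ⟨_, ⟨s, hs, rfl⟩, ⟨Iso.refl _⟩⟩
  | succ n hn' ih =>
    obtain ⟨t, ht, ⟨e⟩⟩ := localCohomology.exists_lower_degree M n hn' s hs
    -- The induction hypothesis carries `4 ≤ n`; at `n = 3` the ideal generated by `t` already
    -- serves as `J`.
    rcases hn'.eq_or_lt with rfl | h
    · exact ⟨_, ⟨t, ht, rfl⟩, ⟨e⟩⟩
    · obtain ⟨J, hJ, ⟨e'⟩⟩ := ih h t ht
      exact ⟨J, hJ, ⟨e ≪≫ e'⟩⟩
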